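/- Let $P\subset\mathbb{R}^m$ be a polytope containing $0$ in its interior, let $S$ be a non-empty face of $P$, and fix a point $z$ in the relative interior of $S$. (Faces of a polytope are its intersections with supporting hyperplanes, together with the empty set and the polytope itself.) Let $L$ be the linear space parallel to the affine hull of $S$, let $p\colon\mathbb{R}^m\to L$ be the orthogonal projection, and put $$S^\vartriangle:=\{a\in L\mid a\bullet x\le 1+a\bullet z\ \ \forall x\in S\},\qquad P^\vartriangle:=\{c\in\mathbb{R}^m\mid c\bullet x\le 1\ \ \forall x\in P\},$$ $$S^\Diamond:=\{c\in P^\vartriangle\mid c\bullet x=1\ \ \forall x\in S\}.$$ For $a\in S^\vartriangle$ let $\mathfrak F(a)$ be the set of all faces $F$ of $P$ (possibly empty) for which there is a $q\in L^\bot$ such that the inequality $(a+q)\bullet x\le 1+a\bullet z+q\bullet z$ holds for all $x\in P$, with equality if and only if $x\in F$. Let $\mathcal S^\circ$ be the partition of $S^\vartriangle$ into the classes of the equivalence relation $a\sim b:\Leftrightarrow\mathfrak F(a)=\mathfrak F(b)$. Let $\mathcal D$ be the deletion of $S^\Diamond$ from the face complex of $P^\vartriangle$, that is, the set of all faces of $P^\vartriangle$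 which are disjoint from $S^\Diamond$. For $c\in\mathbb{R}^m$ with $c\bullet z\ne1$ let $\pi(c):=\frac{1}{1-c\bullet z}\,p(c)$. Let $\mathcal S^\circ_\pi$ be the partition of $S^\vartriangle$ in which two points $a,b$ are in the same class if and only if the fibers $\pi^{-1}(a)$ and $\pi^{-1}(b)$ intersect the same set of faces in $\mathcal D$. Then $\mathcal S^\circ=\mathcal S^\circ_\pi$. -/

import Mathlib

namespace RotationComplex

variable {E : Type*} [NormedAddCommGroup E] [InnerProductSpace ℝ E]

/-- A polytope: the convex hull of a finite set of points. -/
def IsPolytope (P : Set E) : Prop :=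
  ∃ V : Set E, V.Finite ∧ P = convexHull ℝ V

/-- The linear space `L` parallel to the affine hull of `S`. -/
def dirSpace (S : Set E) : Submodule ℝ E :=
  (affineSpan ℝ S).direction

/-- The polar `S^△` of `S` with respect to the point `z` of `S`, a subset of `L`. -/
def facePolar (S : Set E) (z : E) : Set E :=
  {a | a ∈ dirSpace S ∧ ∀ x ∈ S, inner ℝ a x ≤ 1 + inner ℝ a z}

/-- The set `𝔉(a)` of all faces of `P` (the empty face included) that are defined by a valid
inequality for `P` obtained by rotating `a`, that is, by adding an element of `L^⊥`. -/
def rotatedFaces (P S : Set E) (z a : E) : Set (Set E) :=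
  {F | IsExposed ℝ P F ∧ ∃ q ∈ (dirSpace S)ᗮ,
    (∀ x ∈ P, inner ℝ (a + q) x ≤ 1 + inner ℝ a z + inner ℝ q z) ∧
    ∀ x ∈ P, inner ℝ (a + q) x = 1 + inner ℝ a z + inner ℝ q z ↔ x ∈ F}

/-- The rotation partition `𝒮°` of `S^△`: the classes of `a ∼ b ↔ 𝔉(a) = 𝔉(b)`. -/
def rotationPartition (P S : Set E) (z : E) : Set (Set (facePolar S z)) :=
  (Setoid.ker fun a : facePolar S z => rotatedFaces P S z a).classes

/-- The polar `P^△` of `P` (with respect to the origin). -/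
def polar (P : Set E) : Set E :=
  {a | ∀ x ∈ P, inner ℝ a x ≤ 1}

/-- The conjugate face `F^◇` of `F` in `P^△`. -/
def conjFace (P F : Set E) : Set E :=
  {a | a ∈ polar P ∧ ∀ x ∈ F, inner ℝ a x = 1}

/-- The deletion `𝒟` of `S^◇` from the face complex of `P^△`: all faces of `P^△` that are disjoint
from `S^◇`. -/
def deletion (P S : Set E) : Set (Set E) :=
  {G | IsExposed ℝ (polar P) G ∧ Disjoint G (conjFace P S)}

variable [FiniteDimensional ℝ E]

/-- The projective map `π(c) = p(c) / (1 - ⟨c, z⟩)`, where `p` is the orthogonal projection onto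
`L`; it is meaningful where `⟨c, z⟩ ≠ 1`. -/
noncomputable def projMap (S : Set E) (z c : E) : E :=
  (1 - inner ℝ c z)⁻¹ • (dirSpace S).starProjection c

/-- The fiber `π⁻¹(a)`, within the domain of `π`. -/
def fiber (S : Set E) (z a : E) : Set E :=
  {c | inner ℝ c z ≠ 1 ∧ projMap S z c = a}

/-- The set of the faces in `𝒟` that meet the fiber `π⁻¹(a)`. -/
def facesMeetingFiber (P S : Set E) (z a : E) : Set (Set E) :=
  {G | G ∈ deletion P S ∧ (fiber S z a ∩ G).Nonempty}

/-- The partition `𝒮°_π` of `S^△`: two points are in the same class if and only if their fibers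
under `π` intersect the same faces in `𝒟`. -/
def imagePartition (P S : Set E) (z : E) : Set (Set (facePolar S z)) :=
  (Setoid.ker fun a : facePolar S z => facesMeetingFiber P S z a).classes

end RotationComplex

/-!
For `a ∈ L`, the valid inequalities obtained by rotating `a` are given by the vectors `w ∈ a + L^⊥`
for which the slack `x ↦ 1 + ⟪w, z⟫ - ⟪w, x⟫` is nonnegative on `P`. Since `0` is interior to `P`,
the number `1 + ⟪w, z⟫` is positive, and `w ↦ w / (1 + ⟪w, z⟫)` is a bijection from these vectors
onto the part of the fiber `π⁻¹(a)` that lies in `P^△`. Write `F_w` for the face of `P` on which the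
slack of `w` vanishes. Then `𝔉(a)` is the set of all `F_w`, and the point of `P^△` given by `w` lies
in the relative interior of the conjugate face `F_w^◇`.

If `𝔉(a) = 𝔉(b)`, a face `G` of `P^△` that contains the point given by `w` contains the whole of
`F_w^◇`, hence also the point given by any rotation of `b` that defines the same face `F_w`
(`conjFace_subset_of_isExposed`).

Conversely, suppose that the two fibers meet the same faces in `𝒟`, and let `w` be a rotation of
`a`. The face `F_w^◇` may meet `S^◇`, but among the rotations `w'` of `a` with `F_w ⊆ F_{w'}` there
is one for which `F_{w'}^◇` is in `𝒟`: if `g` is a point of `F_{w'}^◇ ∩ S^◇`, then `g ∈ L^⊥`, and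
moving `w'` in the direction `-g` as far as possible enlarges `F_{w'}`
(`exists_disjoint_conjFace`). Therefore `F_{w'}^◇` contains the point given by some rotation `d` of
`b`; now `F_d^◇` is also in `𝒟`, so it contains the point given by a rotation `e` of `a`. This means
`F_w ⊆ F_d ⊆ F_e`. As the slack is affine in the rotation, `d + ε (w - e)` is for small `ε > 0` a
rotation of `b` that defines the face `F_w` (`exists_tightFace_eq`).
-/

namespace RotationComplex

variable {E : Type*} [NormedAddCommGroup E] [InnerProductSpace ℝ E]

/-! ### Rotated inequalities and the faces they define -/

/-- The vectors `w = a + q` with `q ∈ L^⊥` such that `⟪w, x⟫ ≤ 1 + ⟪w, z⟫` holds on `P`. -/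
def rotations (P S : Set E) (z a : E) : Set E :=
  {w | w - a ∈ (dirSpace S)ᗮ ∧ ∀ x ∈ P, inner ℝ w x ≤ 1 + inner ℝ w z}

/-- The set of the points of `P` at which the inequality `⟪w, x⟫ ≤ 1 + ⟪w, z⟫` is tight. -/
def tightFace (P : Set E) (z w : E) : Set E :=
  {x | x ∈ P ∧ inner ℝ w x = 1 + inner ℝ w z}

/-- The normal vector of the inequality `⟪w, x⟫ ≤ 1 + ⟪w, z⟫` after its right-hand side has been
scaled to `1`; it is meaningful where `1 + ⟪w, z⟫ ≠ 0`. -/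
noncomputable def toPolar (z w : E) : E :=
  (1 + inner ℝ w z : ℝ)⁻¹ • w

lemma inner_le_of_mem_convexHull {V : Set E} {u : E} {r : ℝ} (h : ∀ v ∈ V, inner ℝ u v ≤ r)
    {x : E} (hx : x ∈ convexHull ℝ V) : inner ℝ u x ≤ r := by
  have hc : Convex ℝ {y : E | inner ℝ u y ≤ r} :=
    convex_halfSpace_le (innerₛₗ ℝ u).isLinear r
  exact convexHull_min h hc hx

/-- The right-hand side of a valid inequality is positive because `0` is interior to `P`. -/
lemma one_add_inner_pos {P : Set E} (h0 : (0 : E) ∈ interior P) {z w : E}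
    (hw : ∀ x ∈ P, inner ℝ w x ≤ 1 + inner ℝ w z) : 0 < 1 + inner ℝ w z := by
  rcases eq_or_ne w 0 with rfl | hne
  · simp
  · obtain ⟨r, hr, hball⟩ := Metric.mem_nhds_iff.1 (mem_interior_iff_mem_nhds.1 h0)
    have hn : 0 < ‖w‖ := norm_pos_iff.2 hne
    have hmem : (r / 2 / ‖w‖) • w ∈ P := by
      apply hball
      rw [mem_ball_zero_iff, norm_smul, Real.norm_of_nonneg (by positivity),
        div_mul_cancel₀ _ hn.ne']
      linarith
    have h := hw _ hmem
    rw [inner_smul_right, real_inner_self_eq_norm_sq] at h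
    have : 0 < r / 2 / ‖w‖ * ‖w‖ ^ 2 := by positivity
    linarith

lemma inner_toPolar {z w : E} (x : E) :
    inner ℝ (toPolar z w) x = (1 + inner ℝ w z)⁻¹ * inner ℝ w x := by
  rw [toPolar, real_inner_smul_left]

lemma inner_toPolar_eq_one_iff {z w x : E} (ht : 0 < 1 + inner ℝ w z) :
    inner ℝ (toPolar z w) x = 1 ↔ inner ℝ w x = 1 + inner ℝ w z := by
  rw [inner_toPolar, inv_mul_eq_one₀ ht.ne', eq_comm]

lemma toPolar_mem_polar {P : Set E} {z w : E} (ht : 0 < 1 + inner ℝ w z)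
    (hw : ∀ x ∈ P, inner ℝ w x ≤ 1 + inner ℝ w z) : toPolar z w ∈ polar P := by
  intro x hx
  rw [inner_toPolar, inv_mul_le_iff₀ ht, mul_one]
  exact hw x hx

lemma toPolar_mem_conjFace_iff {P : Set E} {z w w' : E} (ht : 0 < 1 + inner ℝ w' z)
    (hw' : ∀ x ∈ P, inner ℝ w' x ≤ 1 + inner ℝ w' z) :
    toPolar z w' ∈ conjFace P (tightFace P z w) ↔ tightFace P z w ⊆ tightFace P z w' := by
  constructor
  · exact fun h x hx => ⟨hx.1, (inner_toPolar_eq_one_iff ht).1 (h.2 x hx)⟩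
  · exact fun h => ⟨toPolar_mem_polar ht hw', fun x hx => (inner_toPolar_eq_one_iff ht).2 (h hx).2⟩

lemma conjFace_anti {P F F' : Set E} (h : F ⊆ F') : conjFace P F' ⊆ conjFace P F :=
  fun _ hd => ⟨hd.1, fun x hx => hd.2 x (h hx)⟩

lemma mem_orthogonal_of_mem_conjFace {P S : Set E} {g : E} (hg : g ∈ conjFace P S) :
    g ∈ (dirSpace S)ᗮ := by
  rw [Submodule.mem_orthogonal', dirSpace, direction_affineSpan]
  intro u hu
  have hle : vectorSpan ℝ S ≤ LinearMap.ker (innerₛₗ ℝ g) := by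
    rw [vectorSpan_def, Submodule.span_le]
    rintro _ ⟨x, hx, y, hy, rfl⟩
    simp [inner_sub_right, hg.2 x hx, hg.2 y hy]
  simpa using hle hu

/-! ### Perturbations within a polytope -/

/-- A nonnegative function on a finite set stays nonnegative under a small perturbation which is
nonnegative at its zeros. -/
lemma exists_pos_add_mul_nonneg {α : Type*} {V : Set α} (hV : V.Finite) {f g : α → ℝ}
    (hf : ∀ v ∈ V, 0 ≤ f v) (hg : ∀ v ∈ V, f v = 0 → 0 ≤ g v) :
    ∃ ε > 0, ∀ v ∈ V, 0 ≤ f v + ε * g v := by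
  have key : ∀ v ∈ V, ∀ᶠ ε in nhdsWithin (0 : ℝ) (Set.Ioi 0), 0 ≤ f v + ε * g v := by
    intro v hv
    rcases (hf v hv).eq_or_lt with h | h
    · filter_upwards [self_mem_nhdsWithin] with ε hε
      rw [← h, zero_add]
      exact mul_nonneg (le_of_lt hε) (hg v hv h.symm)
    · have hc : Filter.Tendsto (fun ε : ℝ => f v + ε * g v) (nhds 0) (nhds (f v + 0 * g v)) :=
        Continuous.tendsto (by fun_prop) 0
      rw [zero_mul, add_zero] at hc
      filter_upwards [nhdsWithin_le_nhds (hc.eventually (lt_mem_nhds h))] with ε hε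
      exact le_of_lt hε
  have hall := (Filter.eventually_all_finite hV).2 key
  obtain ⟨ε, h, hε⟩ := (hall.and self_mem_nhdsWithin).exists
  exact ⟨ε, hε, h⟩

/-- The face defined by a valid inequality depends monotonically on the generators of the polytope
that it contains: on the generators, and hence on `P`, the slack of `w'` is bounded by a multiple of
the slack of `w`. -/
lemma tightFace_subset_of_generators {V : Set E} (hV : V.Finite) {z w w' : E}
    (hw : ∀ v ∈ V, inner ℝ w v ≤ 1 + inner ℝ w z)
    (hw' : ∀ x ∈ convexHull ℝ V, inner ℝ w' x ≤ 1 + inner ℝ w' z)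
    (h : ∀ v ∈ V, inner ℝ w v = 1 + inner ℝ w z → inner ℝ w' v = 1 + inner ℝ w' z) :
    tightFace (convexHull ℝ V) z w ⊆ tightFace (convexHull ℝ V) z w' := by
  obtain ⟨ε, hε, hle⟩ := exists_pos_add_mul_nonneg hV
    (f := fun v => 1 + inner ℝ w z - inner ℝ w v)
    (g := fun v => inner ℝ w' v - (1 + inner ℝ w' z))
    (fun v hv => sub_nonneg.2 (hw v hv))
    (fun v hv h0 => by linarith [h v hv (by linarith)])
  rintro x ⟨hx, htight⟩
  refine ⟨hx, le_antisymm (hw' x hx) ?_⟩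
  have := inner_le_of_mem_convexHull (u := w - ε • w')
    (r := 1 + inner ℝ w z - ε * (1 + inner ℝ w' z)) (fun v hv => by
      have := hle v hv
      rw [inner_sub_left, real_inner_smul_left]
      linarith) hx
  rw [inner_sub_left, real_inner_smul_left, htight] at this
  exact le_of_mul_le_mul_left (by linarith) hε

/-- A point of the polar lies in the relative interior of the conjugate of the face it defines, so
that every face of the polar containing it contains this conjugate face. -/
lemma conjFace_subset_of_isExposed {V G : Set E} (hV : V.Finite) {z w : E}
    (hG : IsExposed ℝ (polar (convexHull ℝ V)) G)
    (ht : 0 < 1 + inner ℝ w z)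
    (hw : ∀ x ∈ convexHull ℝ V, inner ℝ w x ≤ 1 + inner ℝ w z)
    (hmem : toPolar z w ∈ G) :
    conjFace (convexHull ℝ V) (tightFace (convexHull ℝ V) z w) ⊆ G := by
  intro w' hd
  set c := toPolar z w
  have hc : c ∈ polar (convexHull ℝ V) := toPolar_mem_polar ht hw
  obtain ⟨ε, hε, hle⟩ := exists_pos_add_mul_nonneg hV
    (f := fun v => 1 - inner ℝ c v) (g := fun v => inner ℝ w' v - inner ℝ c v)
    (fun v hv => sub_nonneg.2 (hc v (subset_convexHull ℝ V hv)))
    (fun v hv h0 => by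
      have h1 : inner ℝ c v = 1 := by linarith
      have h2 := hd.2 v ⟨subset_convexHull ℝ V hv, (inner_toPolar_eq_one_iff ht).1 h1⟩
      linarith)
  -- the segment from `w'` to `c` can be prolonged beyond `c` within the polar
  have hy : c + ε • (c - w') ∈ polar (convexHull ℝ V) := by
    intro x hx
    refine inner_le_of_mem_convexHull (fun v hv => ?_) hx
    have := hle v hv
    rw [inner_add_left, real_inner_smul_left, inner_sub_left]
    linarith
  obtain ⟨l, rfl⟩ := hG ⟨c, hmem⟩
  refine ⟨hd.1, fun y hy' => (hmem.2 y hy').trans ?_⟩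
  have := hmem.2 _ hy
  simp only [map_add, map_smul, map_sub, smul_eq_mul] at this
  nlinarith

/-! ### Conjugate faces -/

/-- The conjugate of a face of a polytope is exposed by the sum of the generators in that face. -/
lemma isExposed_conjFace_tightFace {V : Set E} (hV : V.Finite) {z w : E}
    (ht : 0 < 1 + inner ℝ w z)
    (hw : ∀ x ∈ convexHull ℝ V, inner ℝ w x ≤ 1 + inner ℝ w z) :
    IsExposed ℝ (polar (convexHull ℝ V))
      (conjFace (convexHull ℝ V) (tightFace (convexHull ℝ V) z w)) := by
  classical
  intro _
  set c := toPolar z w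
  have hc : c ∈ polar (convexHull ℝ V) := toPolar_mem_polar ht hw
  let T : Finset E := hV.toFinset.filter fun v => inner ℝ c v = 1
  have hT : ∀ {v}, v ∈ T ↔ v ∈ V ∧ inner ℝ c v = 1 := by simp [T]
  have hl : ∀ d, innerSL ℝ (∑ v ∈ T, v) d = ∑ v ∈ T, inner ℝ d v := by
    intro d
    rw [innerSL_apply_apply, real_inner_comm, inner_sum]
  refine ⟨innerSL ℝ (∑ v ∈ T, v), Set.ext fun d => ⟨fun hd => ⟨hd.1, fun y hy => ?_⟩, fun hd => ?_⟩⟩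
  · rw [hl, hl]
    refine Finset.sum_le_sum fun v hv => ?_
    have hvP := subset_convexHull ℝ V (hT.1 hv).1
    rw [hd.2 v ⟨hvP, (inner_toPolar_eq_one_iff ht).1 (hT.1 hv).2⟩]
    exact hy v hvP
  · have hdle : ∀ v ∈ T, inner ℝ d v ≤ inner ℝ c v := fun v hv => by
      rw [(hT.1 hv).2]
      exact hd.1 v (subset_convexHull ℝ V (hT.1 hv).1)
    have hge := hd.2 c hc
    rw [hl, hl] at hge
    have heq := (Finset.sum_eq_sum_iff_of_le hdle).1 (le_antisymm (Finset.sum_le_sum hdle) hge)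
    have hsub : tightFace (convexHull ℝ V) 0 c ⊆ tightFace (convexHull ℝ V) 0 d := by
      refine tightFace_subset_of_generators hV (fun v hv => ?_) (fun x hx => ?_) fun v hv h1 => ?_
      · simpa using hc v (subset_convexHull ℝ V hv)
      · simpa using hd.1 x hx
      · rw [inner_zero_right, add_zero] at h1 ⊢
        rw [heq v (hT.2 ⟨hv, h1⟩), h1]
    refine ⟨hd.1, fun x hx => ?_⟩
    have h1 : inner ℝ c x = 1 := (inner_toPolar_eq_one_iff ht).2 hx.2
    simpa using (hsub ⟨hx.1, by simpa using h1⟩).2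

/-- If the conjugates of `F_w` and `S` have a common point `g`, then moving `w` in the direction
`-g` as far as validity permits makes the inequality tight at a further generator. -/
lemma exists_generators_ssubset {V S : Set E} (hV : V.Finite) {z a w g : E} (hzS : z ∈ S)
    (h0 : (0 : E) ∈ convexHull ℝ V)
    (hw : w ∈ rotations (convexHull ℝ V) S z a)
    (hgw : g ∈ conjFace (convexHull ℝ V) (tightFace (convexHull ℝ V) z w))
    (hgS : g ∈ conjFace (convexHull ℝ V) S) :
    ∃ w' ∈ rotations (convexHull ℝ V) S z a,
      V ∩ tightFace (convexHull ℝ V) z w ⊂ V ∩ tightFace (convexHull ℝ V) z w' := by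
  have hVP := subset_convexHull ℝ V
  have hgz : inner ℝ g z = 1 := hgS.2 z hzS
  let U : Set E := {v | v ∈ V ∧ inner ℝ g v < 1}
  have hUne : U.Nonempty := by
    by_contra hne
    have h1 : ∀ v ∈ V, inner ℝ (-g) v ≤ -1 := fun v hv => by
      rw [inner_neg_left, neg_le_neg_iff]
      exact not_lt.1 fun hlt => hne ⟨v, hv, hlt⟩
    have := inner_le_of_mem_convexHull h1 h0
    rw [inner_zero_right] at this
    linarith
  have hUfin : U.Finite := hV.subset fun v hv => hv.1
  obtain ⟨m, hmU, hmin⟩ := Set.exists_min_image U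
    (fun v => (1 + inner ℝ w z - inner ℝ w v) / (1 - inner ℝ g v)) hUfin hUne
  set lam := (1 + inner ℝ w z - inner ℝ w m) / (1 - inner ℝ g m) with hlam
  have hm1 : 0 < 1 - inner ℝ g m := sub_pos.2 hmU.2
  have hslack : ∀ x, 1 + inner ℝ (w - lam • g) z - inner ℝ (w - lam • g) x =
      1 + inner ℝ w z - inner ℝ w x - lam * (1 - inner ℝ g x) := fun x => by
    simp only [inner_sub_left, real_inner_smul_left, hgz]
    ring
  have hvalid : ∀ v ∈ V, inner ℝ (w - lam • g) v ≤ 1 + inner ℝ (w - lam • g) z := by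
    intro v hv
    rw [← sub_nonneg, hslack, sub_nonneg]
    rcases (hgw.1 v (hVP hv)).eq_or_lt with h | h
    · rw [h, sub_self, mul_zero]
      exact sub_nonneg.2 (hw.2 v (hVP hv))
    · exact (le_div_iff₀ (sub_pos.2 h)).1 (hmin v ⟨hv, h⟩)
  refine ⟨w - lam • g, ⟨?_, fun x hx => inner_le_of_mem_convexHull hvalid hx⟩, ?_⟩
  · rw [sub_right_comm]
    exact Submodule.sub_mem _ hw.1 (Submodule.smul_mem _ _ (mem_orthogonal_of_mem_conjFace hgS))
  · rw [Set.ssubset_iff_of_subset]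
    · refine ⟨m, ⟨hmU.1, hVP hmU.1, ?_⟩, fun hm => hmU.2.ne (hgw.2 m hm.2)⟩
      have := hslack m
      rw [hlam, div_mul_cancel₀ _ hm1.ne', sub_self, ← hlam] at this
      linarith
    · rintro v ⟨hv, hvt⟩
      refine ⟨hv, hvt.1, ?_⟩
      have := hslack v
      rw [hgw.2 v hvt, hvt.2] at this
      linarith

/-- The face defined by a rotation of `a` is contained in one whose conjugate face belongs to the
deletion of `S^◇`. -/
lemma exists_disjoint_conjFace {V S : Set E} (hV : V.Finite) {z a w : E} (hzS : z ∈ S)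
    (h0 : (0 : E) ∈ convexHull ℝ V)
    (hw : w ∈ rotations (convexHull ℝ V) S z a) :
    ∃ w' ∈ rotations (convexHull ℝ V) S z a,
      tightFace (convexHull ℝ V) z w ⊆ tightFace (convexHull ℝ V) z w' ∧
      Disjoint (conjFace (convexHull ℝ V) (tightFace (convexHull ℝ V) z w'))
        (conjFace (convexHull ℝ V) S) := by
  let C : Set (Set E) := {T | ∃ w' ∈ rotations (convexHull ℝ V) S z a,
    T = V ∩ tightFace (convexHull ℝ V) z w'}
  have hC : C.Finite := hV.finite_subsets.subset fun T ⟨_, _, hT⟩ => hT ▸ Set.inter_subset_left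
  obtain ⟨T, hle, ⟨⟨w', hw', rfl⟩, hmax⟩⟩ := hC.exists_le_maximal ⟨w, hw, rfl⟩
  refine ⟨w', hw', ?_, Set.disjoint_left.2 fun g hgw hgS => ?_⟩
  · exact tightFace_subset_of_generators hV (fun v hv => hw.2 v (subset_convexHull ℝ V hv)) hw'.2
      fun v hv h => (hle ⟨hv, subset_convexHull ℝ V hv, h⟩).2.2
  · obtain ⟨w'', hw'', hss⟩ := exists_generators_ssubset hV hzS h0 hw' hgw hgS
    exact hss.not_subset (hmax ⟨w'', hw'', rfl⟩ hss.subset)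

/-- If `F_w ⊆ F_d ⊆ F_e` for rotations `w`, `e` of `a` and `d` of `b`, then `F_w` is also defined by
a rotation of `b`, namely by `d + ε (w - e)` for small `ε > 0`. -/
lemma exists_tightFace_eq {V S : Set E} (hV : V.Finite) {z a b w d e : E}
    (hw : w ∈ rotations (convexHull ℝ V) S z a)
    (hd : d ∈ rotations (convexHull ℝ V) S z b)
    (he : e ∈ rotations (convexHull ℝ V) S z a)
    (hwd : tightFace (convexHull ℝ V) z w ⊆ tightFace (convexHull ℝ V) z d)
    (hde : tightFace (convexHull ℝ V) z d ⊆ tightFace (convexHull ℝ V) z e) :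
    ∃ w' ∈ rotations (convexHull ℝ V) S z b,
      tightFace (convexHull ℝ V) z w' = tightFace (convexHull ℝ V) z w := by
  have hVP := subset_convexHull ℝ V
  -- halving the admissible `ε` keeps the slack positive where the slack of `d` is positive
  obtain ⟨ε, hε, hle⟩ := exists_pos_add_mul_nonneg hV
    (f := fun v => 1 + inner ℝ d z - inner ℝ d v)
    (g := fun v => (1 + inner ℝ w z - inner ℝ w v) - (1 + inner ℝ e z - inner ℝ e v))
    (fun v hv => sub_nonneg.2 (hd.2 v (hVP hv)))
    (fun v hv h => by
      have h1 := (hde ⟨hVP hv, by linarith⟩).2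
      linarith [hw.2 v (hVP hv)])
  have hslack : ∀ x, 1 + inner ℝ (d + (ε / 2) • (w - e)) z - inner ℝ (d + (ε / 2) • (w - e)) x =
      (1 + inner ℝ d z - inner ℝ d x) + ε / 2 *
        ((1 + inner ℝ w z - inner ℝ w x) - (1 + inner ℝ e z - inner ℝ e x)) := fun x => by
    simp only [inner_add_left, inner_sub_left, real_inner_smul_left]
    ring
  have hvalid : ∀ v ∈ V, inner ℝ (d + (ε / 2) • (w - e)) v ≤
      1 + inner ℝ (d + (ε / 2) • (w - e)) z := by
    intro v hv
    rw [← sub_nonneg, hslack]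
    linarith [hle v hv, hd.2 v (hVP hv)]
  refine ⟨d + (ε / 2) • (w - e), ⟨?_, fun x hx => inner_le_of_mem_convexHull hvalid hx⟩, ?_⟩
  · rw [show d + (ε / 2) • (w - e) - b = (d - b) + (ε / 2) • ((w - a) - (e - a)) by
      rw [sub_sub_sub_cancel_right]; abel]
    exact Submodule.add_mem _ hd.1 (Submodule.smul_mem _ _ (Submodule.sub_mem _ hw.1 he.1))
  · refine (tightFace_subset_of_generators hV hvalid hw.2 fun v hv h => ?_).antisymm
      fun x hx => ⟨hx.1, ?_⟩
    · have hs := hslack v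
      have h2 := hle v hv
      have hdv := hd.2 v (hVP hv)
      have h3 : inner ℝ d v = 1 + inner ℝ d z := by linarith
      have h4 := (hde ⟨hVP hv, h3⟩).2
      have h5 : ε / 2 * (1 + inner ℝ w z - inner ℝ w v) = 0 := by
        rw [h3, h4] at hs
        linarith
      rcases mul_eq_zero.1 h5 with h6 | h6 <;> linarith
    · have hs := hslack x
      rw [hx.2, (hwd hx).2, (hde (hwd hx)).2] at hs
      linarith

/-! ### Rotations and the fibers of the projection -/

lemma mem_rotatedFaces_iff {P S F : Set E} {z a : E} :
    F ∈ rotatedFaces P S z a ↔ ∃ w ∈ rotations P S z a, F = tightFace P z w := by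
  constructor
  · rintro ⟨hF, q, hq, hle, heq⟩
    refine ⟨a + q, ⟨by simpa using hq, fun x hx => ?_⟩, Set.ext fun x => ?_⟩
    · rw [inner_add_left a q z, ← add_assoc]
      exact hle x hx
    · rw [tightFace, Set.mem_ofPred_eq, inner_add_left a q z, ← add_assoc]
      exact ⟨fun hx => ⟨hF.subset hx, (heq x (hF.subset hx)).2 hx⟩, fun hx => (heq x hx.1).1 hx.2⟩
  · rintro ⟨w, hw, rfl⟩
    have hz : 1 + inner ℝ a z + inner ℝ (w - a) z = 1 + inner ℝ w z := by
      rw [inner_sub_left]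
      ring
    refine ⟨fun ⟨x₀, hx₀⟩ => ⟨innerSL ℝ w, Set.ext fun x => ?_⟩, w - a, hw.1, ?_, ?_⟩
    · simp only [innerSL_apply_apply]
      refine ⟨fun hx => ⟨hx.1, fun y hy => (hw.2 y hy).trans hx.2.ge⟩, fun hx => ⟨hx.1, ?_⟩⟩
      exact le_antisymm (hw.2 x hx.1) (hx₀.2.symm.le.trans (hx.2 x₀ hx₀.1))
    · rw [add_sub_cancel, hz]
      exact hw.2
    · rw [add_sub_cancel, hz]
      exact fun x hx => ⟨fun h => ⟨hx, h⟩, fun h => h.2⟩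

variable [FiniteDimensional ℝ E]

/-- The rotations of `a` correspond to the points of the fiber `π⁻¹(a)` in the polar of `P`. -/
lemma fiber_inter_polar {P S : Set E} (h0 : (0 : E) ∈ interior P) {z a : E} (hz : z ∈ P)
    (ha : a ∈ dirSpace S) :
    fiber S z a ∩ polar P = toPolar z '' rotations P S z a := by
  ext c
  constructor
  · rintro ⟨⟨hne, hc⟩, hcP⟩
    have hpos : 0 < 1 - inner ℝ c z := sub_pos.2 (lt_of_le_of_ne (hcP z hz) hne)
    have ht : (1 : ℝ) + inner ℝ ((1 - inner ℝ c z)⁻¹ • c) z = (1 - inner ℝ c z)⁻¹ := by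
      rw [real_inner_smul_left]
      field_simp
      ring
    refine ⟨(1 - inner ℝ c z)⁻¹ • c, ⟨?_, fun x hx => ?_⟩, ?_⟩
    · rw [← hc, projMap, ← smul_sub]
      exact Submodule.smul_mem _ _ (Submodule.sub_starProjection_mem_orthogonal c)
    · rw [ht, real_inner_smul_left]
      exact mul_le_of_le_one_right (inv_nonneg.2 hpos.le) (hcP x hx)
    · rw [toPolar, ht, inv_inv, smul_smul, mul_inv_cancel₀ hpos.ne', one_smul]
  · rintro ⟨w, hw, rfl⟩
    have ht := one_add_inner_pos h0 hw.2
    have hz' : 1 - inner ℝ (toPolar z w) z = (1 + inner ℝ w z)⁻¹ := by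
      rw [inner_toPolar]
      field_simp
      ring
    refine ⟨⟨fun h => ?_, ?_⟩, toPolar_mem_polar ht hw.2⟩
    · rw [h, sub_self] at hz'
      exact (inv_pos.2 ht).ne hz'
    · rw [projMap, hz', inv_inv, toPolar, map_smul, smul_smul, mul_inv_cancel₀ ht.ne', one_smul]
      exact Submodule.eq_starProjection_of_mem_orthogonal ha hw.1

lemma mem_facesMeetingFiber_iff {P S G : Set E} (h0 : (0 : E) ∈ interior P) {z a : E} (hz : z ∈ P)
    (ha : a ∈ dirSpace S) :
    G ∈ facesMeetingFiber P S z a ↔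
      G ∈ deletion P S ∧ ∃ w ∈ rotations P S z a, toPolar z w ∈ G := by
  refine and_congr_right fun hG => ?_
  have hGP : fiber S z a ∩ G = toPolar z '' rotations P S z a ∩ G := by
    rw [← fiber_inter_polar h0 hz ha, Set.inter_assoc, Set.inter_eq_right.2 hG.1.subset]
  rw [hGP]
  constructor
  · rintro ⟨_, ⟨w, hw, rfl⟩, h⟩
    exact ⟨w, hw, h⟩
  · rintro ⟨w, hw, h⟩
    exact ⟨_, ⟨w, hw, rfl⟩, h⟩

/-! ### Comparison of the two partitions -/

lemma facesMeetingFiber_subset {V S : Set E} (hV : V.Finite)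
    (h0 : (0 : E) ∈ interior (convexHull ℝ V)) {z a b : E} (hz : z ∈ convexHull ℝ V)
    (ha : a ∈ dirSpace S) (hb : b ∈ dirSpace S)
    (h : rotatedFaces (convexHull ℝ V) S z a ⊆ rotatedFaces (convexHull ℝ V) S z b) :
    facesMeetingFiber (convexHull ℝ V) S z a ⊆ facesMeetingFiber (convexHull ℝ V) S z b := by
  intro G hG
  rw [mem_facesMeetingFiber_iff h0 hz ha] at hG
  rw [mem_facesMeetingFiber_iff h0 hz hb]
  obtain ⟨hGD, w, hw, hwG⟩ := hG
  obtain ⟨w', hw', heq⟩ := mem_rotatedFaces_iff.1 (h (mem_rotatedFaces_iff.2 ⟨w, hw, rfl⟩))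
  refine ⟨hGD, w', hw', conjFace_subset_of_isExposed hV hGD.1 (one_add_inner_pos h0 hw.2) hw.2
    hwG ?_⟩
  exact (toPolar_mem_conjFace_iff (one_add_inner_pos h0 hw'.2) hw'.2).2 heq.subset

lemma rotatedFaces_subset {V S : Set E} (hV : V.Finite)
    (h0 : (0 : E) ∈ interior (convexHull ℝ V)) {z a b : E} (hz : z ∈ convexHull ℝ V)
    (hzS : z ∈ S) (ha : a ∈ dirSpace S) (hb : b ∈ dirSpace S)
    (h : facesMeetingFiber (convexHull ℝ V) S z a = facesMeetingFiber (convexHull ℝ V) S z b) :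
    rotatedFaces (convexHull ℝ V) S z a ⊆ rotatedFaces (convexHull ℝ V) S z b := by
  -- a rotation of `a₁` whose conjugate face is in the deletion yields one of `a₂` that defines a
  -- larger face
  have transfer : ∀ {a₁ a₂ w : E}, a₁ ∈ dirSpace S → a₂ ∈ dirSpace S →
      facesMeetingFiber (convexHull ℝ V) S z a₁ = facesMeetingFiber (convexHull ℝ V) S z a₂ →
      w ∈ rotations (convexHull ℝ V) S z a₁ →
      Disjoint (conjFace (convexHull ℝ V) (tightFace (convexHull ℝ V) z w))
        (conjFace (convexHull ℝ V) S) →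
      ∃ d ∈ rotations (convexHull ℝ V) S z a₂,
        tightFace (convexHull ℝ V) z w ⊆ tightFace (convexHull ℝ V) z d := by
    intro a₁ a₂ w h₁ h₂ heq hw hdisj
    have ht := one_add_inner_pos h0 hw.2
    have hmem := (mem_facesMeetingFiber_iff h0 hz h₁).2
      ⟨⟨isExposed_conjFace_tightFace hV ht hw.2, hdisj⟩, w, hw,
        (toPolar_mem_conjFace_iff ht hw.2).2 subset_rfl⟩
    rw [heq, mem_facesMeetingFiber_iff h0 hz h₂] at hmem
    obtain ⟨-, d, hd, hdG⟩ := hmem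
    exact ⟨d, hd, (toPolar_mem_conjFace_iff (one_add_inner_pos h0 hd.2) hd.2).1 hdG⟩
  intro F hF
  obtain ⟨w, hw, rfl⟩ := mem_rotatedFaces_iff.1 hF
  obtain ⟨w', hw', hsub, hdisj⟩ := exists_disjoint_conjFace hV hzS (interior_subset h0) hw
  obtain ⟨d, hd, hwd⟩ := transfer ha hb h hw' hdisj
  obtain ⟨e, he, hde⟩ := transfer hb ha h.symm hd (hdisj.mono_left (conjFace_anti hwd))
  obtain ⟨u, hu, heq⟩ := exists_tightFace_eq hV hw hd he (hsub.trans hwd) hde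
  exact mem_rotatedFaces_iff.2 ⟨u, hu, heq.symm⟩

end RotationComplex

theorem mainTheorem6 {E : Type*} [NormedAddCommGroup E] [InnerProductSpace ℝ E]
    [FiniteDimensional ℝ E] (P S : Set E) (z : E)
    (hP : RotationComplex.IsPolytope P) (h0 : (0 : E) ∈ interior P)
    (hS : IsExposed ℝ P S) (hz : z ∈ intrinsicInterior ℝ S) :
    RotationComplex.rotationPartition P S z = RotationComplex.imagePartition P S z := by
  obtain ⟨V, hV, rfl⟩ := hP
  have hzS : z ∈ S := intrinsicInterior_subset hz
  have hzP := hS.subset hzS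
  unfold RotationComplex.rotationPartition RotationComplex.imagePartition
  congr 1
  ext a b
  rw [Setoid.ker_def, Setoid.ker_def]
  constructor
  · intro h
    exact (RotationComplex.facesMeetingFiber_subset hV h0 hzP a.2.1 b.2.1 h.subset).antisymm
      (RotationComplex.facesMeetingFiber_subset hV h0 hzP b.2.1 a.2.1 h.symm.subset)
  · intro h
    exact (RotationComplex.rotatedFaces_subset hV h0 hzP hzS a.2.1 b.2.1 h).antisymm
      (RotationComplex.rotatedFaces_subset hV h0 hzP hzS b.2.1 a.2.1 h.symm)
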